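/- Let $k\ge 1$ be an integer and let $G$ be a profinite group (that is, a compact Hausdorff totally disconnected topological group). For elements of $G$ put $[x_1,x_2]=x_1^{-1}x_2^{-1}x_1x_2$ and, inductively, $[x_1,\dots,x_{n+1}]=[[x_1,\dots,x_n],x_{n+1}]$ for $n\ge 2$. Let $\mathrm{np}_k(G)$ be the measure of the set $$\{(x_1,\dots,x_{k+1})\in G^{k+1} : [x_1,\dots,x_{k+1}]=1\}$$ with respect to the normalized Haar measure on the compact group $G^{k+1}$. If $\mathrm{np}_k(G)>0$, then $G$ has an open subgroup that is nilpotent of class at most $k$. -/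

import Mathlib

/-- The group commutator in the convention `[a, b] = a⁻¹ b⁻¹ a b`. -/
def groupComm {G : Type*} [Group G] (a b : G) : G := a⁻¹ * b⁻¹ * a * b

/-- The left-normed iterated commutator of `k + 1` elements:
`[x₁] = x₁` and `[x₁, …, xₖ₊₂] = [[x₁, …, xₖ₊₁], xₖ₊₂]`. -/
def iterComm {G : Type*} [Group G] : (k : ℕ) → (Fin (k + 1) → G) → G
  | 0, x => x 0
  | k + 1, x => groupComm (iterComm k (fun i => x i.castSucc)) (x (Fin.last (k + 1)))

/-- The set of all `(x₁, …, xₖ₊₁) ∈ G ^ (k + 1)` with `[x₁, …, xₖ₊₁] = 1`. -/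
def nilpotentTuples (k : ℕ) (G : Type*) [Group G] : Set (Fin (k + 1) → G) :=
  {x | iterComm k x = 1}

/-- The degree of `k`-nilpotence `np_k(G)` of a compact group `G`: the measure of
`nilpotentTuples k G` for the normalized Haar measure of the compact group `G ^ (k + 1)`.
That Haar measure lives on the Borel sets of the product topology; for groups that are not second
countable these need not be the product sigma-algebra, hence the explicit `borel`. -/
noncomputable def nilpotentDegree (k : ℕ) (G : Type*) [Group G] [TopologicalSpace G]
    [IsTopologicalGroup G] [CompactSpace G] : ENNReal :=
  letI : MeasurableSpace (Fin (k + 1) → G) := borel _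
  haveI : BorelSpace (Fin (k + 1) → G) := ⟨rfl⟩
  MeasureTheory.Measure.haarMeasure (⊤ : TopologicalSpace.PositiveCompacts (Fin (k + 1) → G))
    (nilpotentTuples k G)

/-! The ratio for each finite quotient `G ⧸ M` is at least `np_k(G)`
(`nilpotentDegree_le_nilpotentRatio`), so the infimum of these ratios is positive. Pick `N` with
ratio within a factor `1 / (1 - 2^-(k+1))` of the infimum. For open normal `M ≤ N`, passing from `G
⧸ N` to `G ⧸ M` then loses too little for `N/M` not to have class at most `k`
(`lowerCentralSeries_ker_eq_bot`). Hence the `k`-th lower central term of `N` lies in every such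
`M`, and these intersect trivially.

The gap is finite counting: a subgroup containing more than half of a coset `aN` contains `N`, and
iterating this costs a factor 2 per commutator entry. -/

theorem Subgroup.le_of_two_mul_card_lt {F : Type*} [Group F] (N : Subgroup F) [Finite N]
    (H : Subgroup F) (a : F) (h : 2 * Nat.card {n : N // a * n ∉ H} < Nat.card N) : N ≤ H := by
  classical
  have := Fintype.ofFinite N
  intro x hx
  let S : Finset N := Finset.univ.filter fun n => a * n ∉ H
  have hS : 2 * S.card < Fintype.card N := by
    simpa [Nat.card_eq_fintype_card, Fintype.card_subtype] using h
  let T : Finset N := S.image fun n => n * (⟨x, hx⟩ : N)⁻¹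
  have hT : T.card ≤ S.card := Finset.card_image_le
  -- `n ∉ T` says that `n * x ∉ S`, so both `a * n` and `a * (n * x)` lie in `H`; their quotient is
  -- `x`.
  obtain ⟨n, hn⟩ : ∃ n, n ∉ S ∪ T := by
    by_contra! hall
    have h1 : (S ∪ T) = Finset.univ := Finset.eq_univ_iff_forall.2 hall
    have h2 := Finset.card_union_le S T
    rw [h1, Finset.card_univ] at h2
    omega
  have h1 : a * n ∈ H := by
    by_contra hc
    exact hn (Finset.mem_union_left _ (by simpa [S] using hc))
  have h2 : a * (n * x) ∈ H := by
    by_contra hc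
    refine hn (Finset.mem_union_right _ (Finset.mem_image.2 ⟨n * ⟨x, hx⟩, ?_, by simp⟩))
    simpa [S] using hc
  have h3 := H.mul_mem (H.inv_mem h1) h2
  have h4 : (a * (n : F))⁻¹ * (a * (n * x)) = x := by group
  rwa [h4] at h3

theorem map_groupComm {F Q : Type*} [Group F] [Group Q] (f : F →* Q) (x y : F) :
    f (groupComm x y) = groupComm (f x) (f y) := by
  simp [groupComm]

theorem map_iterComm {F Q : Type*} [Group F] [Group Q] (f : F →* Q) :
    ∀ (k : ℕ) (x : Fin (k + 1) → F), f (iterComm k x) = iterComm k fun i => f (x i)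
  | 0, _ => rfl
  | k + 1, x => by simp only [iterComm, map_groupComm, map_iterComm f k]

theorem groupComm_eq_one_iff {F : Type*} [Group F] (x y : F) :
    groupComm x y = 1 ↔ y * x = x * y := by
  rw [groupComm, mul_assoc, ← mul_inv_rev, inv_mul_eq_one]

/-- The elements of `F` that commute with `N` modulo `K`. -/
def Subgroup.centralizerMod {F : Type*} [Group F] (N K : Subgroup F) [K.Normal] : Subgroup F :=
  (Subgroup.centralizer (N.map (QuotientGroup.mk' K) : Set (F ⧸ K))).comap (QuotientGroup.mk' K)

instance {F : Type*} [Group F] (N K : Subgroup F) [N.Normal] [K.Normal] :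
    (N.centralizerMod K).Normal := by
  have : (N.map (QuotientGroup.mk' K)).Normal :=
    Subgroup.Normal.map inferInstance _ (QuotientGroup.mk'_surjective K)
  unfold Subgroup.centralizerMod
  infer_instance

/-- For fixed `x` the admissible `y` form a subgroup, so the more-than-half criterion applies to the
last entry of a commutator. -/
theorem groupComm_mem_iff {F : Type*} [Group F] (K : Subgroup F) [K.Normal] (x y : F) :
    groupComm x y ∈ K ↔
      y ∈ (Subgroup.centralizer {QuotientGroup.mk' K x}).comap (QuotientGroup.mk' K) := by
  rw [← QuotientGroup.eq_one_iff, ← QuotientGroup.mk'_apply, map_groupComm, groupComm_eq_one_iff,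
    Subgroup.mem_comap, Subgroup.mem_centralizer_singleton_iff]

theorem Subgroup.mem_centralizerMod_iff {F : Type*} [Group F] (N K : Subgroup F) [K.Normal]
    (x : F) : x ∈ N.centralizerMod K ↔ ∀ y ∈ N, groupComm x y ∈ K := by
  simp only [groupComm_mem_iff, Subgroup.centralizerMod, Subgroup.mem_comap,
    Subgroup.mem_centralizer_iff, Subgroup.coe_map, Set.forall_mem_image, SetLike.mem_coe,
    Set.mem_singleton_iff, forall_eq]
  exact forall₂_congr fun _ _ => eq_comm

/-- A subgroup on most of whose translated tuples the iterated commutator lies in `K` is nilpotent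
modulo `K`. -/
theorem lowerCentralSeries_le_of_card_lt {F : Type*} [Group F] (N : Subgroup F) [N.Normal]
    [Finite N] (m : ℕ) : ∀ (K : Subgroup F) [K.Normal] (a : Fin (m + 1) → F),
    2 ^ (m + 1) * Nat.card {n : Fin (m + 1) → N // iterComm m (fun i => a i * n i) ∉ K} <
      Nat.card N ^ (m + 1) → N.lowerCentralSeries m ≤ K := by
  induction m with
  | zero =>
    intro K _ a h
    refine N.le_of_two_mul_card_lt K (a 0) ?_
    have e : {n : Fin 1 → N // iterComm 0 (fun i => a i * n i) ∉ K} ≃ {n : N // a 0 * n ∉ K} :=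
      (Equiv.funUnique (Fin 1) N).subtypeEquiv fun n => Iff.rfl
    simpa [Nat.card_congr e] using h
  | succ m ih =>
    intro K _ a h
    -- Double counting: if the commutator of the first `m + 1` entries fails to centralize `N`
    -- modulo `K`, at least half of the last entries are bad.
    have key : Nat.card {n : Fin (m + 1) → N //
          iterComm m (fun i => a i.castSucc * n i) ∉ N.centralizerMod K} * Nat.card N ≤
        2 * Nat.card {n : Fin (m + 2) → N // iterComm (m + 1) (fun i => a i * n i) ∉ K} := by
      classical
      set B := {n : Fin (m + 1) → N //
          iterComm m (fun i => a i.castSucc * n i) ∉ N.centralizerMod K}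
      have := Fintype.ofFinite B
      let c : B → F := fun n => iterComm m fun i => a i.castSucc * n.1 i
      have hfib (n : B) : Nat.card N ≤
          2 * Nat.card {y : N // groupComm (c n) (a (Fin.last _) * y) ∉ K} := by
        by_contra! hlt
        simp only [groupComm_mem_iff] at hlt
        have hle := N.le_of_two_mul_card_lt _ _ hlt
        exact n.2 ((N.mem_centralizerMod_iff K _).2 fun y hy =>
          (groupComm_mem_iff K _ _).2 (hle hy))
      let g : (Σ n : B, {y : N // groupComm (c n) (a (Fin.last _) * y) ∉ K}) →
          {n : Fin (m + 2) → N // iterComm (m + 1) (fun i => a i * n i) ∉ K} :=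
        fun p => ⟨Fin.snoc p.1.1 p.2.1, by
          have := p.2.2
          simpa [iterComm, c] using this⟩
      have hg : Function.Injective g := by
        rintro ⟨⟨n, hn⟩, ⟨y, hy⟩⟩ ⟨⟨n', hn'⟩, ⟨y', hy'⟩⟩ h
        have h' : (Fin.snoc n y : Fin (m + 2) → N) = Fin.snoc n' y' := congrArg Subtype.val h
        obtain ⟨rfl, rfl⟩ := Fin.snoc_injective2 h'
        rfl
      have hcard := Nat.card_le_card_of_injective g hg
      rw [Nat.card_sigma] at hcard
      calc Nat.card B * Nat.card N = ∑ _n : B, Nat.card N := by simp [Nat.card_eq_fintype_card]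
        _ ≤ ∑ n : B, 2 * Nat.card {y : N // groupComm (c n) (a (Fin.last _) * y) ∉ K} :=
            Finset.sum_le_sum fun n _ => hfib n
        _ ≤ _ := by
            rw [← Finset.mul_sum]
            exact Nat.mul_le_mul_left _ hcard
    have hpos : 0 < Nat.card N := Nat.card_pos
    have hle := ih (N.centralizerMod K) (fun i => a i.castSucc) (by
      refine Nat.lt_of_mul_lt_mul_right (a := Nat.card N) ?_
      calc _ = 2 ^ (m + 1) * (Nat.card {n : Fin (m + 1) → N //
              iterComm m (fun i => a i.castSucc * n i) ∉ N.centralizerMod K} * Nat.card N) := by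
            ring
        _ ≤ 2 ^ (m + 1) * (2 * Nat.card {n : Fin (m + 2) → N //
              iterComm (m + 1) (fun i => a i * n i) ∉ K}) := Nat.mul_le_mul_left _ key
        _ = 2 ^ (m + 1 + 1) * Nat.card {n : Fin (m + 2) → N //
              iterComm (m + 1) (fun i => a i * n i) ∉ K} := by ring
        _ < Nat.card N ^ (m + 1 + 1) := h
        _ = _ := by ring)
    rw [Subgroup.lowerCentralSeries_succ, Subgroup.commutator_le]
    intro p hp q hq
    -- The inverses convert `groupComm` to Mathlib's `⁅p, q⁆ = p * q * p⁻¹ * q⁻¹`.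
    have hpq := (N.mem_centralizerMod_iff K _).1 (inv_mem (hle hp)) q⁻¹ (inv_mem hq)
    simpa [groupComm, commutatorElement_def] using hpq

/-- The proportion of tuples of a finite group whose iterated commutator is trivial. -/
noncomputable def nilpotentRatio (k : ℕ) (Q : Type*) [Group Q] : ℝ :=
  Nat.card (nilpotentTuples k Q) / (Nat.card Q : ℝ) ^ (k + 1)

/-- Solutions in `F` lie over solutions in `Q`. If the conclusion failed, at least `2^-(k+1)` of the
lifts of every tuple would have nontrivial commutator, contradicting `h`. -/
theorem lowerCentralSeries_ker_eq_bot {F Q : Type*} [Group F] [Group Q] [Finite F]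
    (f : F →* Q) (hf : Function.Surjective f) (k : ℕ)
    (h : (1 - 1 / 2 ^ (k + 1)) * nilpotentRatio k Q < nilpotentRatio k F) :
    f.ker.lowerCentralSeries k = ⊥ := by
  classical
  have : Finite Q := Finite.of_surjective f hf
  have := Fintype.ofFinite (nilpotentTuples k Q)
  have hcardF : Nat.card F = Nat.card Q * Nat.card f.ker := by
    rw [Subgroup.card_eq_card_quotient_mul_card_subgroup f.ker,
      Nat.card_congr (QuotientGroup.quotientKerEquivOfSurjective f hf).toEquiv]
  choose s hs using hf
  by_contra hne
  have hfib (t : Fin (k + 1) → Q) : Nat.card f.ker ^ (k + 1) ≤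
      2 ^ (k + 1) * Nat.card {n : Fin (k + 1) → f.ker //
        iterComm k (fun i => s (t i) * n i) ≠ 1} := by
    by_contra! hlt
    exact hne (le_bot_iff.1 (lowerCentralSeries_le_of_card_lt f.ker k ⊥ (fun i => s (t i))
      (by simpa using hlt)))
  have hsplit (t : Fin (k + 1) → Q) :
      Nat.card {n : Fin (k + 1) → f.ker // iterComm k (fun i => s (t i) * n i) = 1} +
      Nat.card {n : Fin (k + 1) → f.ker // iterComm k (fun i => s (t i) * n i) ≠ 1} =
      Nat.card f.ker ^ (k + 1) := by
    rw [← Nat.card_sum, Nat.card_congr (Equiv.sumCompl _), Nat.card_fun, Nat.card_fin]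
  let g : nilpotentTuples k F → Σ t : nilpotentTuples k Q,
      {n : Fin (k + 1) → f.ker // iterComm k (fun i => s (t.1 i) * n i) = 1} :=
    fun x => ⟨⟨fun i => f (x.1 i), by
        have hx : iterComm k x.1 = 1 := x.2
        change iterComm k _ = 1
        rw [← map_iterComm, hx, map_one]⟩,
      ⟨fun i => ⟨(s (f (x.1 i)))⁻¹ * x.1 i, by simp [MonoidHom.mem_ker, hs]⟩, by
        have hx : iterComm k x.1 = 1 := x.2
        simpa using hx⟩⟩
  have hg : Function.Injective g := by
    let r : (Σ t : nilpotentTuples k Q,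
        {n : Fin (k + 1) → f.ker // iterComm k (fun i => s (t.1 i) * n i) = 1}) →
        (Fin (k + 1) → F) := fun p i => s (p.1.1 i) * p.2.1 i
    have hr (x) : r (g x) = x.1 := by
      funext i
      simp [r, g]
    intro x y hxy
    rw [Subtype.ext_iff, ← hr x, ← hr y, hxy]
  have hcard := Nat.card_le_card_of_injective g hg
  rw [Nat.card_sigma] at hcard
  have hN : (0 : ℝ) < Nat.card f.ker := by exact_mod_cast Nat.card_pos
  have hQ : (0 : ℝ) < Nat.card Q := by exact_mod_cast Nat.card_pos
  have hle (t : Fin (k + 1) → Q) :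
      (Nat.card {n : Fin (k + 1) → f.ker // iterComm k (fun i => s (t i) * n i) = 1} : ℝ) ≤
      (1 - 1 / 2 ^ (k + 1)) * (Nat.card f.ker : ℝ) ^ (k + 1) := by
    have h1 : (Nat.card f.ker : ℝ) ^ (k + 1) ≤ 2 ^ (k + 1) * Nat.card {n : Fin (k + 1) → f.ker //
        iterComm k (fun i => s (t i) * n i) ≠ 1} := by exact_mod_cast hfib t
    have h2 : (Nat.card {n : Fin (k + 1) → f.ker // iterComm k (fun i => s (t i) * n i) = 1} : ℝ) +
      Nat.card {n : Fin (k + 1) → f.ker // iterComm k (fun i => s (t i) * n i) ≠ 1} =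
      (Nat.card f.ker : ℝ) ^ (k + 1) := by exact_mod_cast hsplit t
    have h3 := (div_le_iff₀' (by positivity)).2 h1
    rw [sub_mul, one_mul, one_div_mul_eq_div]
    linarith
  have htotal : (Nat.card (nilpotentTuples k F) : ℝ) ≤ Nat.card (nilpotentTuples k Q) *
      ((1 - 1 / 2 ^ (k + 1)) * (Nat.card f.ker : ℝ) ^ (k + 1)) := by
    refine (Nat.cast_le.2 hcard).trans ?_
    push_cast
    refine (Finset.sum_le_sum fun t _ => hle t.1).trans (le_of_eq ?_)
    simp [Nat.card_eq_fintype_card]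
  refine absurd h (not_lt.2 ?_)
  rw [nilpotentRatio, nilpotentRatio, hcardF, Nat.cast_mul, mul_pow, div_le_iff₀ (by positivity)]
  refine htotal.trans (le_of_eq ?_)
  field_simp

/-- The fibres of `G^(k+1) → (G ⧸ M)^(k+1)` are translates of one another, hence of equal measure,
and those over solutions cover the solutions in `G`. -/
theorem nilpotentDegree_le_nilpotentRatio {G : Type*} [Group G] [TopologicalSpace G]
    [IsTopologicalGroup G] [CompactSpace G] (k : ℕ) (M : OpenNormalSubgroup G) :
    nilpotentDegree k G ≤ ENNReal.ofReal (nilpotentRatio k (G ⧸ (M : Subgroup G))) := by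
  classical
  let Q := G ⧸ (M : Subgroup G)
  have : Finite Q := Subgroup.quotient_finite_of_isOpen _ M.isOpen
  have := Fintype.ofFinite Q
  have := Fintype.ofFinite (nilpotentTuples k Q)
  let : MeasurableSpace (Fin (k + 1) → G) := borel _
  have : BorelSpace (Fin (k + 1) → G) := ⟨rfl⟩
  let μ := MeasureTheory.Measure.haarMeasure
    (⊤ : TopologicalSpace.PositiveCompacts (Fin (k + 1) → G))
  have huniv : μ Set.univ = 1 := MeasureTheory.Measure.haarMeasure_self
  let π : (Fin (k + 1) → G) → (Fin (k + 1) → Q) :=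
    fun x i => QuotientGroup.mk' (M : Subgroup G) (x i)
  have hπ : Function.Surjective π := fun t => by
    choose s hs using fun i => QuotientGroup.mk'_surjective (M : Subgroup G) (t i)
    exact ⟨s, funext hs⟩
  have : DiscreteTopology Q := QuotientGroup.discreteTopology M.isOpen
  have hcont : Continuous π :=
    continuous_pi fun i => continuous_quotient_mk'.comp (continuous_apply i)
  have hmeas (t) : MeasurableSet (π ⁻¹' {t}) :=
    ((isOpen_discrete {t}).preimage hcont).measurableSet
  have hconst (t) : μ (π ⁻¹' {t}) = μ (π ⁻¹' {1}) := by
    obtain ⟨a, rfl⟩ := hπ t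
    rw [← MeasureTheory.measure_preimage_mul μ a (π ⁻¹' {π a})]
    congr 1
    ext x
    have : π (a * x) = π a * π x := by
      funext i
      simp [π]
    simp [this]
  have hdisj : Pairwise (Function.onFun Disjoint fun t => π ⁻¹' {t}) := fun t t' h =>
    Disjoint.preimage _ (Set.disjoint_singleton.2 h)
  have hsum : (Fintype.card (Fin (k + 1) → Q) : ENNReal) * μ (π ⁻¹' {1}) = 1 := by
    rw [← huniv, ← Set.preimage_univ (f := π), ← Set.iUnion_of_singleton, Set.preimage_iUnion,
      MeasureTheory.measure_iUnion hdisj hmeas, tsum_fintype]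
    simp [hconst]
  have hval : μ (π ⁻¹' {1}) = (Fintype.card (Fin (k + 1) → Q) : ENNReal)⁻¹ :=
    ENNReal.eq_inv_of_mul_eq_one_left (by rwa [mul_comm])
  have hsub : nilpotentTuples k G ⊆ ⋃ t : nilpotentTuples k Q, π ⁻¹' {t.1} := fun x hx => by
    have hx : iterComm k x = 1 := hx
    refine Set.mem_iUnion.2 ⟨⟨π x, ?_⟩, rfl⟩
    change iterComm k _ = 1
    rw [← map_iterComm, hx, map_one]
  calc nilpotentDegree k G = μ (nilpotentTuples k G) := rfl
    _ ≤ μ (⋃ t : nilpotentTuples k Q, π ⁻¹' {t.1}) := MeasureTheory.measure_mono hsub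
    _ ≤ ∑ t : nilpotentTuples k Q, μ (π ⁻¹' {t.1}) := MeasureTheory.measure_iUnion_fintype_le _ _
    _ = Nat.card (nilpotentTuples k Q) * (Fintype.card (Fin (k + 1) → Q) : ENNReal)⁻¹ := by
        simp [hconst, hval, Nat.card_eq_fintype_card]
    _ = ENNReal.ofReal (nilpotentRatio k Q) := by
        rw [nilpotentRatio, ENNReal.ofReal_div_of_pos (by
          have : 0 < Nat.card Q := Nat.card_pos
          positivity), div_eq_mul_inv, ENNReal.ofReal_natCast,
          ← Nat.cast_pow, ENNReal.ofReal_natCast]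
        simp [Nat.card_eq_fintype_card]

theorem theorem2p10 (k : ℕ) (hk : 1 ≤ k) (G : Type*) [Group G] [TopologicalSpace G]
    [IsTopologicalGroup G] [CompactSpace G] [T2Space G] [TotallyDisconnectedSpace G]
    (hG : 0 < nilpotentDegree k G) :
    ∃ H : Subgroup G, IsOpen (H : Set G) ∧
      ∃ _ : Group.IsNilpotent H, Group.nilpotencyClass H ≤ k := by
  let d : OpenNormalSubgroup G → ℝ := fun M => nilpotentRatio k (G ⧸ (M : Subgroup G))
  obtain ⟨M₀, -⟩ :=
    ProfiniteGrp.exist_openNormalSubgroup_sub_open_nhds_of_one isOpen_univ (Set.mem_univ (1 : G))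
  have : Nonempty (OpenNormalSubgroup G) := ⟨M₀⟩
  have hbdd : BddBelow (Set.range d) := ⟨0, by
    rintro _ ⟨M, rfl⟩
    simp only [d, nilpotentRatio]
    positivity⟩
  have hd (M) : nilpotentDegree k G ≤ ENNReal.ofReal (d M) := nilpotentDegree_le_nilpotentRatio k M
  have hfin : nilpotentDegree k G ≠ ⊤ := ne_top_of_le_ne_top ENNReal.ofReal_ne_top (hd M₀)
  have hpos : 0 < ⨅ M, d M := by
    refine (ENNReal.toReal_pos hG.ne' hfin).trans_le (le_ciInf fun M => ?_)
    exact ENNReal.toReal_le_of_le_ofReal (by simp only [d, nilpotentRatio]; positivity) (hd M)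
  have hε : (0 : ℝ) < 1 - 1 / 2 ^ (k + 1) := by
    rw [sub_pos, div_lt_one (by positivity)]
    exact one_lt_pow₀ one_lt_two (by omega)
  have hε' : (1 : ℝ) - 1 / 2 ^ (k + 1) < 1 := sub_lt_self _ (by positivity)
  obtain ⟨N, hN⟩ : ∃ N, d N < (⨅ M, d M) / (1 - 1 / 2 ^ (k + 1)) :=
    exists_lt_of_ciInf_lt ((lt_div_iff₀ hε).2 (mul_lt_of_lt_one_right hpos hε'))
  have hle (M : OpenNormalSubgroup G) (hMN : (M : Subgroup G) ≤ N) :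
      (N : Subgroup G).lowerCentralSeries k ≤ M := by
    have : Finite (G ⧸ (M : Subgroup G)) := Subgroup.quotient_finite_of_isOpen _ M.isOpen
    let f : G ⧸ (M : Subgroup G) →* G ⧸ (N : Subgroup G) :=
      QuotientGroup.map _ _ (MonoidHom.id G) hMN
    have hf : Function.Surjective f := by
      intro y
      obtain ⟨g, rfl⟩ := QuotientGroup.mk_surjective y
      exact ⟨g, rfl⟩
    have hbot := lowerCentralSeries_ker_eq_bot f hf k (by
      rw [lt_div_iff₀' hε] at hN
      exact hN.trans_le (ciInf_le hbdd M))
    have hmap : (N : Subgroup G).map (QuotientGroup.mk' (M : Subgroup G)) ≤ f.ker := by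
      rintro _ ⟨x, hx, rfl⟩
      exact (QuotientGroup.eq_one_iff x).2 hx
    have hlcs := Subgroup.lowerCentralSeries_mono k hmap
    beta_reduce at hlcs
    rwa [hbot, ← Subgroup.map_lowerCentralSeries, le_bot_iff, Subgroup.map_eq_bot_iff,
      QuotientGroup.ker_mk'] at hlcs
  have hlcs : (N : Subgroup G).lowerCentralSeries k = ⊥ := by
    refine (Subgroup.eq_bot_iff_forall _).2 fun x hx => ?_
    by_contra hne
    obtain ⟨M, hM⟩ := ProfiniteGrp.exist_openNormalSubgroup_sub_open_nhds_of_one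
      (isOpen_compl_singleton (x := x)) (Ne.symm hne)
    have hmem : x ∈ ((M ⊓ N : OpenNormalSubgroup G) : Subgroup G) :=
      hle (M ⊓ N) (fun y hy => hy.2) hx
    exact hM hmem.1 rfl
  have hnil : Group.IsNilpotent (N : Subgroup G) :=
    Subgroup.isNilpotent_of_lowerCentralSeries_eq_bot hlcs
  refine ⟨N, N.isOpen, hnil, Subgroup.lowerCentralSeries_eq_bot_iff_nilpotencyClass_le.1 ?_⟩
  -- The series of `N` as a group in itself is carried to the series computed inside `G`.
  rwa [← Subgroup.map_subtype_inj, Subgroup.map_bot, Subgroup.top_subtype_lowerCentralSeries]
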